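/- Let $X$ be a finite topological space, with the preorder $p\le q \iff \overline{\{p\}}\subseteq\overline{\{q\}}$; write $C_p=\overline{\{p\}}$ and let $U_p$ be the smallest open set containing $p$. An abelian data on $X$ is a functor $F$ from this preorder to abelian groups. For a subspace $S\subseteq X$ put $L(S,F)=\varinjlim_{s\in S}F_s$, and let $H_i(S,-)$ denote the left derived functors of $L(S,-)$ on abelian data on $S$. For a continuous map $f\colon X\to Y$ of finite spaces, let $f_!F$ be the abelian data on $Y$ with $(f_!F)_y=L(f^{-1}(C_y),F)$, and let $L_if_!$ be the left derived functors of $f_!$. A finite space $S$ is homologically trivial if $H_0(S,\mathbb Z)\cong\mathbb Z$ and $H_i(S,\mathbb Z)=0$ for all $i>0$. Theorem. Let $f\colon X\to Y$ be a continuous map of finite topological spaces. The following are equivalent: 1. $f$ is homologically open: $f$ is open and, for every $x\in X$ and every $y\in U_{f(x)}$, the fiber $U_x\cap f^{-1}(y)$ of the induced map $U_x\to U_{f(x)}$ is homologically trivial. 2. $f$ satisfies base change for homology: for every abelian data $F$ on $X$, every $y\in Y$ and every $i\ge 0$, the base change morphism $$H_i\bigl(f^{-1}(y),F|_{f^{-1}(y)}\bigr)\longrightarrow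 (L_if_!F)_y$$ is an isomorphism. Here, for projective resolutions $P\to F$ and $Q\to F|_{f^{-1}(y)}$ and a morphism $Q\to P|_{f^{-1}(y)}$ over the identity of $F|_{f^{-1}(y)}$, the base change morphism is the one induced on $H_i$ by $L(f^{-1}(y),Q)\to L(f^{-1}(y),P)\to L(f^{-1}(C_y),P)=(f_!P)_y$. -/

import Mathlib

open CategoryTheory CategoryTheory.Limits

universe v u

namespace FiniteSpace

noncomputable section

/-! ## Abelian data

`Specialization X` is the set `X` with the preorder `p ≤ q ↔ closure {p} ⊆ closure {q}`,
regarded as a category. -/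

/-- Abelian data on `X`: functors from the preorder of specializations of `X` to abelian groups. -/
abbrev AbData (X : Type v) [TopologicalSpace X] : Type (max v (u + 1)) :=
  Specialization X ⥤ AddCommGrpCat.{u}

section Spaces

variable {X : Type u} [TopologicalSpace X] {Y : Type v} [TopologicalSpace Y]

/-- The order on `Specialization X` is the one given by inclusion of closures of points. -/
theorem specialization_le_iff (p q : X) :
    Specialization.toEquiv p ≤ Specialization.toEquiv q ↔
      closure ({p} : Set X) ⊆ closure {q} :=
  specializes_iff_closure_subset

/-- `U_x`, the smallest open subset containing `x`. -/
def minOpen (x : X) : Set X := nhdsKer {x}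

/-- In a finite space, `minOpen x` is the least open subset containing `x`. -/
theorem minOpen_isLeast [Finite X] (x : X) : IsLeast {U : Set X | IsOpen U ∧ x ∈ U} (minOpen x) :=
  ⟨⟨isOpen_nhdsKer, subset_nhdsKer rfl⟩,
    fun _ hU => nhdsKer_minimal (Set.singleton_subset_iff.2 hU.2) hU.1⟩

/-- The functor between specialization preorders given by a continuous map. -/
def specMap {X : Type u} [TopologicalSpace X] {Y : Type v} [TopologicalSpace Y] (f : C(X, Y)) :
    Specialization X ⥤ Specialization Y :=
  (Specialization.map f).monotone.functor

/-- The inclusion of a subspace into the whole space. -/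
def subspaceInc (S : Set X) : C(S, X) := ⟨Subtype.val, continuous_subtype_val⟩

/-- The inclusion between two nested subspaces. -/
def nestedInc {S T : Set X} (h : S ⊆ T) : C(S, T) := ⟨Set.inclusion h, continuous_inclusion h⟩

/-- Inverse image of abelian data, `(f⁻¹ F)_x = F_{f x}`. -/
def inverseImage (f : C(X, Y)) : AbData.{v, u} Y ⥤ AbData.{u, u} X :=
  (Functor.whiskeringLeft _ _ _).obj (specMap f)

/-- Restriction of abelian data to a subspace, `F ↦ F|_S`. -/
def restrict (S : Set X) : AbData.{u, u} X ⥤ AbData.{u, u} S :=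
  inverseImage (subspaceInc S)

/-- Constant abelian data. -/
def constData (X : Type u) [TopologicalSpace X] (G : AddCommGrpCat.{u}) : AbData.{u, u} X :=
  (Functor.const _).obj G

/-! ## Cosections and `f_!` -/

/-- The cosections functor `L(X, -)`, i.e. the direct limit over the points of `X`. -/
def cosections (X : Type u) [TopologicalSpace X] : AbData.{u, u} X ⥤ AddCommGrpCat.{u} :=
  colim

/-- Cosections on a subspace, `L(S, F)`. -/
def cosectionsOn (S : Set X) : AbData.{u, u} X ⥤ AddCommGrpCat.{u} :=
  restrict S ⋙ cosections S

/-- The natural morphism `F_s ⟶ L(S, F)` for `s ∈ S`. -/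
def toCosections (S : Set X) (F : AbData.{u, u} X) (s : S) :
    F.obj (Specialization.toEquiv s.1) ⟶ (cosectionsOn S).obj F :=
  colimit.ι ((restrict S).obj F) (Specialization.toEquiv s)

theorem toCosections_naturality (S : Set X) {F G : AbData.{u, u} X} (φ : F ⟶ G) (s : S) :
    toCosections S F s ≫ (cosectionsOn S).map φ =
      φ.app (Specialization.toEquiv s.1) ≫ toCosections S G s :=
  ι_colimMap ((restrict S).map φ) (Specialization.toEquiv s)

theorem cosectionsOn_hom_ext {S : Set X} {F : AbData.{u, u} X} {A : AddCommGrpCat.{u}}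
    {a b : (cosectionsOn S).obj F ⟶ A}
    (h : ∀ s : S, toCosections S F s ≫ a = toCosections S F s ≫ b) : a = b :=
  colimit.hom_ext fun s => h (Specialization.ofEquiv s)

/-- Functoriality of cosections in the subspace: `L(S, F) ⟶ L(T, F)` for `S ⊆ T`. -/
def cosectionsMapApp {S T : Set X} (h : S ⊆ T) (F : AbData.{u, u} X) :
    (cosectionsOn S).obj F ⟶ (cosectionsOn T).obj F :=
  colimit.pre ((restrict T).obj F) (specMap (nestedInc h))

theorem toCosections_mapApp {S T : Set X} (h : S ⊆ T) (F : AbData.{u, u} X) (s : S) :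
    toCosections S F s ≫ cosectionsMapApp h F = toCosections T F ⟨s.1, h s.2⟩ :=
  colimit.ι_pre ((restrict T).obj F) (specMap (nestedInc h)) (Specialization.toEquiv s)

/-- The morphisms `L(S, F) ⟶ L(T, F)` for `S ⊆ T` are natural in `F`. -/
def cosectionsMap {S T : Set X} (h : S ⊆ T) : cosectionsOn S ⟶ cosectionsOn T where
  app F := cosectionsMapApp h F
  naturality F G φ := by
    refine cosectionsOn_hom_ext fun s => ?_
    rw [← Category.assoc, toCosections_naturality, Category.assoc, toCosections_mapApp,
      ← Category.assoc, toCosections_mapApp, toCosections_naturality]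

theorem toCosections_map {S T : Set X} (h : S ⊆ T) (F : AbData.{u, u} X) (s : S) :
    toCosections S F s ≫ (cosectionsMap h).app F = toCosections T F ⟨s.1, h s.2⟩ :=
  toCosections_mapApp h F s

theorem cosectionsMap_id {S : Set X} (h : S ⊆ S) : cosectionsMap h = 𝟙 _ := by
  ext1; funext F
  refine cosectionsOn_hom_ext fun s => ?_
  rw [toCosections_map]
  exact (Category.comp_id _).symm

theorem cosectionsMap_comp {S T R : Set X} (h : S ⊆ T) (k : T ⊆ R) :
    cosectionsMap (h.trans k) = cosectionsMap h ≫ cosectionsMap k := by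
  ext1; funext F
  refine cosectionsOn_hom_ext fun s => ?_
  rw [NatTrans.comp_app, ← Category.assoc, toCosections_map, toCosections_map, toCosections_map]

/-- For `y ≤ y'` in `Y` one has `f⁻¹(C_y) ⊆ f⁻¹(C_{y'})`, where `C_y` is the closure of `y`. -/
theorem preimage_closure_mono (f : C(X, Y)) {y y' : Specialization Y} (h : y ≤ y') :
    f ⁻¹' closure {Specialization.ofEquiv y} ⊆ f ⁻¹' closure {Specialization.ofEquiv y'} :=
  Set.preimage_mono ((specialization_le_iff _ _).1 h)

/-- The direct image `f_!`, with `(f_! F)_y = L(f⁻¹(C_y), F)`, `C_y` the closure of `y`. -/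
def lowerShriek (f : C(X, Y)) : AbData.{u, u} X ⥤ AbData.{v, u} Y where
  obj F :=
    { obj := fun y => (cosectionsOn (f ⁻¹' closure {Specialization.ofEquiv y})).obj F
      map := fun g => (cosectionsMap (preimage_closure_mono f (leOfHom g))).app F
      map_id := fun y => by rw [cosectionsMap_id]; rfl
      map_comp := fun g h => by
        rw [← NatTrans.comp_app, ← cosectionsMap_comp] }
  map φ :=
    { app := fun y => (cosectionsOn (f ⁻¹' closure {Specialization.ofEquiv y})).map φ
      naturality := fun _ _ _ => ((cosectionsMap _).naturality φ).symm }
  map_id F := by ext1; funext y; exact CategoryTheory.Functor.map_id (cosectionsOn _) F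
  map_comp φ ψ := by ext1; funext y; exact CategoryTheory.Functor.map_comp (cosectionsOn _) φ ψ

instance (f : C(X, Y)) : (inverseImage f).Additive where
  map_add := rfl

instance (S : Set X) : (restrict S).Additive := inferInstanceAs (inverseImage _).Additive

instance (f : C(X, Y)) : PreservesFiniteLimits (inverseImage f) :=
  inferInstanceAs (PreservesFiniteLimits ((Functor.whiskeringLeft _ _ _).obj (specMap f)))

instance (f : C(X, Y)) : PreservesFiniteColimits (inverseImage f) :=
  inferInstanceAs (PreservesFiniteColimits ((Functor.whiskeringLeft _ _ _).obj (specMap f)))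

instance (S : Set X) : PreservesFiniteLimits (restrict S) :=
  inferInstanceAs (PreservesFiniteLimits (inverseImage _))

instance (S : Set X) : PreservesFiniteColimits (restrict S) :=
  inferInstanceAs (PreservesFiniteColimits (inverseImage _))

instance : (cosections X).Additive :=
  inferInstanceAs (colim (J := Specialization X) (C := AddCommGrpCat.{u})).Additive

instance (S : Set X) : (cosectionsOn S).Additive :=
  inferInstanceAs (restrict S ⋙ cosections S).Additive

instance (f : C(X, Y)) : (lowerShriek f).Additive where
  map_add {F G φ ψ} := by
    ext1; funext y
    exact (cosectionsOn (f ⁻¹' closure {Specialization.ofEquiv y})).map_add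

end Spaces

/-! ## Enough projectives -/

instance : EnoughProjectives AddCommGrpCat.{u} :=
  (forget₂ (ModuleCat.{u} ℤ) AddCommGrpCat.{u}).asEquivalence.enoughProjectives_iff.1
    ModuleCat.enoughProjectives

instance enoughProjectives_functor (J : Type u) [SmallCategory J] :
    EnoughProjectives (J ⥤ AddCommGrpCat.{u}) where
  presentation F := by
    have hproj (j : J) : Projective
        ((evaluationLeftAdjoint AddCommGrpCat.{u} j).obj (Projective.over (F.obj j))) :=
      (evaluationAdjunctionRight AddCommGrpCat.{u} j).map_projective _ inferInstance
    refine ⟨{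
      p := ∐ fun j : J => (evaluationLeftAdjoint AddCommGrpCat.{u} j).obj
        (Projective.over (F.obj j))
      projective := inferInstance
      f := Sigma.desc fun j => ((evaluationAdjunctionRight AddCommGrpCat.{u} j).homEquiv _ _).symm
        (Projective.π (F.obj j))
      epi := ?_ }⟩
    rw [NatTrans.epi_iff_epi_app]
    intro j
    refine epi_of_epi_fac (f := ((evaluationAdjunctionRight AddCommGrpCat.{u} j).homEquiv _ _)
      (Sigma.ι (fun j : J => (evaluationLeftAdjoint AddCommGrpCat.{u} j).obj
        (Projective.over (F.obj j))) j)) (h := Projective.π (F.obj j)) ?_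
    have := (evaluationAdjunctionRight AddCommGrpCat.{u} j).homEquiv_naturality_right
      (Sigma.ι (fun j : J => (evaluationLeftAdjoint AddCommGrpCat.{u} j).obj
        (Projective.over (F.obj j))) j)
      (Sigma.desc fun j => ((evaluationAdjunctionRight AddCommGrpCat.{u} j).homEquiv _ _).symm
        (Projective.π (F.obj j)))
    refine this.symm.trans ?_
    rw [Sigma.ι_desc, Equiv.apply_symm_apply]

/-! ## Lifting a projective resolution to an arbitrary resolution -/

section Lift

variable {A : Type*} [Category* A] [Abelian A]

theorem exists_lift_to_resolution {Z : A} (Q : ProjectiveResolution Z) (K : ChainComplex A ℕ)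
    (ε : K ⟶ (ChainComplex.single₀ A).obj Z) [QuasiIso ε] :
    ∃ φ : Q.complex ⟶ K, φ ≫ ε = Q.π := by
  have hd : K.d 1 0 ≫ ε.f 0 = 0 := by
    rw [← ε.comm 1 0, HomologicalComplex.single_obj_d, comp_zero]
  have hiso : IsIso (HomologicalComplex.opcyclesMap ε 0) := by
    have h : HomologicalComplex.opcyclesMap ε 0 = K.isoHomologyι₀.inv ≫
        HomologicalComplex.homologyMap ε 0 ≫ (ChainComplex.isoHomologyι₀ _).hom := by
      rw [ChainComplex.isoHomologyι₀_inv_naturality_assoc, Iso.inv_hom_id, Category.comp_id]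
    rw [h]
    infer_instance
  let e : K.opcycles 0 ≅ Z := asIso (HomologicalComplex.opcyclesMap ε 0) ≪≫
    (HomologicalComplex.singleObjOpcyclesSelfIso (ComplexShape.down ℕ) 0 Z).symm
  have he : K.pOpcycles 0 ≫ e.hom = ε.f 0 := by
    have h1 : K.pOpcycles 0 ≫ e.hom = (K.pOpcycles 0 ≫ HomologicalComplex.opcyclesMap ε 0) ≫
        (HomologicalComplex.singleObjOpcyclesSelfIso (ComplexShape.down ℕ) 0 Z).inv :=
      (Category.assoc _ _ _).symm
    rw [h1, HomologicalComplex.p_opcyclesMap]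
    refine (Category.assoc _ _ _).trans ?_
    exact (congrArg (ε.f 0 ≫ ·)
      (HomologicalComplex.pOpcycles_singleObjOpcyclesSelfIso_inv (ComplexShape.down ℕ) 0 Z)).trans
      (Category.comp_id _)
  have hc : IsColimit (CokernelCofork.ofπ (f := K.d 1 0) (ε.f 0) hd) :=
    IsColimit.ofIsoColimit (K.opcyclesIsCokernel 1 0 (by simp)) (Cofork.ext e he)
  have h0 : (ShortComplex.mk _ _ hd).Exact := ShortComplex.exact_of_g_is_cokernel _ hc
  have hepi : Epi (ε.f 0) := epi_of_isColimit_cofork hc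
  have hs (n : ℕ) : (ShortComplex.mk _ _ (K.d_comp_d (n + 2) (n + 1) n)).Exact := by
    have h : K.ExactAt (n + 1) := by
      rw [← quasiIsoAt_iff_exactAt' ε (n + 1)
        (ChainComplex.exactAt_succ_single_obj _ _)]
      infer_instance
    exact ((HomologicalComplex.exactAt_iff' _ (n + 2) (n + 1) n) (by simp) (by simp)).1 h
  let φ₀ : Q.complex.X 0 ⟶ K.X 0 := Projective.factorThru (Q.π.f 0) (ε.f 0)
  have hφ₀ : φ₀ ≫ ε.f 0 = Q.π.f 0 := Projective.factorThru_comp _ _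
  have w : (Q.complex.d 1 0 ≫ φ₀) ≫ ε.f 0 = 0 := by
    rw [Category.assoc, hφ₀, Q.complex_d_comp_π_f_zero]
  let φ₁ : Q.complex.X 1 ⟶ K.X 1 := h0.liftFromProjective (Q.complex.d 1 0 ≫ φ₀) w
  have hφ₁ : φ₁ ≫ K.d 1 0 = Q.complex.d 1 0 ≫ φ₀ := h0.liftFromProjective_comp _ w
  refine ⟨ChainComplex.mkHom _ _ φ₀ φ₁ hφ₁ fun n p =>
    ⟨(hs n).liftFromProjective (Q.complex.d (n + 2) (n + 1) ≫ p.2.1) ?_,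
      (hs n).liftFromProjective_comp _ _⟩, ?_⟩
  · dsimp
    rw [Category.assoc, p.2.2, ← Category.assoc, Q.complex.d_comp_d, zero_comp]
  · refine HomologicalComplex.to_single_hom_ext ?_
    simpa using hφ₀

/-- A morphism from a projective resolution of `Z` to an arbitrary resolution of `Z`, over the
identity of `Z` (it is unique up to homotopy). -/
def liftToResolution {Z : A} (Q : ProjectiveResolution Z) (K : ChainComplex A ℕ)
    (ε : K ⟶ (ChainComplex.single₀ A).obj Z) [QuasiIso ε] : Q.complex ⟶ K :=
  (exists_lift_to_resolution Q K ε).choose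

theorem liftToResolution_comp {Z : A} (Q : ProjectiveResolution Z) (K : ChainComplex A ℕ)
    (ε : K ⟶ (ChainComplex.single₀ A).obj Z) [QuasiIso ε] :
    liftToResolution Q K ε ≫ ε = Q.π :=
  (exists_lift_to_resolution Q K ε).choose_spec

end Lift

/-! ## Homology -/

section Homology

/-- Homology `H_i(X, -)`: the left derived functors of cosections. -/
def homology (X : Type u) [TopologicalSpace X] (i : ℕ) : AbData.{u, u} X ⥤ AddCommGrpCat.{u} :=
  (cosections X).leftDerived i

variable {X : Type u} [TopologicalSpace X] {Y : Type v} [TopologicalSpace Y]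

/-- `L_i f_!`: the left derived functors of `f_!`. -/
def derivedLowerShriek (f : C(X, Y)) (i : ℕ) : AbData.{u, u} X ⥤ AbData.{v, u} Y :=
  (lowerShriek f).leftDerived i

/-- `X` is homologically trivial: `H_i(X, ℤ) = 0` for `i > 0` and `H_0(X, ℤ) ≅ ℤ`. -/
def HomologicallyTrivial (X : Type u) [TopologicalSpace X] : Prop :=
  (∀ i : ℕ, 0 < i →
    IsZero ((homology X i).obj (constData X (AddCommGrpCat.of (ULift.{u} ℤ))))) ∧
  Nonempty ((homology X 0).obj (constData X (AddCommGrpCat.of (ULift.{u} ℤ))) ≅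
    AddCommGrpCat.of (ULift.{u} ℤ))

/-- A homologically open map: `f` is open and, for each `x`, all the fibers of
`f|_{U_x} : U_x → U_{f x}` are homologically trivial. -/
def HomologicallyOpen (f : C(X, Y)) : Prop :=
  IsOpenMap f ∧ ∀ x : X, ∀ y ∈ minOpen (f x),
    HomologicallyTrivial (minOpen x ∩ f ⁻¹' {y} : Set X)

theorem fiber_subset (f : C(X, Y)) (y : Y) : f ⁻¹' {y} ⊆ f ⁻¹' closure {y} :=
  Set.preimage_mono subset_closure

/-- The underived base change morphism `L(f⁻¹(y), F|_{f⁻¹(y)}) ⟶ (f_! F)_y`, natural in `F`,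
induced by the inclusion `f⁻¹(y) ⊆ f⁻¹(C_y)`. -/
def baseChange₀ (f : C(X, Y)) (y : Y) :
    restrict (f ⁻¹' {y}) ⋙ cosections (f ⁻¹' {y} : Set X) ⟶
      lowerShriek f ⋙ (evaluation _ _).obj (Specialization.toEquiv y) where
  app F := (cosectionsMap (fiber_subset f y)).app F
  naturality _ _ φ := (cosectionsMap (fiber_subset f y)).naturality φ

/-- The restriction to a subspace of a resolution is a resolution: the augmentation. -/
def restrictAugmentation (S : Set X) {F : AbData.{u, u} X} (P : ProjectiveResolution F) :
    ((restrict S).mapHomologicalComplex _).obj P.complex ⟶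
      (ChainComplex.single₀ _).obj ((restrict S).obj F) :=
  ((restrict S).mapHomologicalComplex _).map P.π ≫
    (HomologicalComplex.singleMapHomologicalComplex (restrict S) (ComplexShape.down ℕ) 0).hom.app F

instance (S : Set X) {F : AbData.{u, u} X} (P : ProjectiveResolution F) :
    QuasiIso (restrictAugmentation S P) := by
  unfold restrictAugmentation
  infer_instance

/-- The base change morphism `H_i(f⁻¹(y), F|_{f⁻¹(y)}) ⟶ (L_i f_! F)_y`. With projective
resolutions `P → F` and `Q → F|_{f⁻¹(y)}`, it is the morphism induced on `H_i` by
`L(f⁻¹(y), Q) → L(f⁻¹(y), P|_{f⁻¹(y)}) → (f_! P)_y`. -/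
def baseChange (f : C(X, Y)) (i : ℕ) (F : AbData.{u, u} X) (y : Y) :
    (homology (f ⁻¹' {y} : Set X) i).obj ((restrict (f ⁻¹' {y})).obj F) ⟶
      ((derivedLowerShriek f i).obj F).obj (Specialization.toEquiv y) :=
  let P := projectiveResolution F
  let Q := projectiveResolution ((restrict (f ⁻¹' {y})).obj F)
  let ev : AbData.{v, u} Y ⥤ AddCommGrpCat.{u} :=
    (evaluation _ _).obj (Specialization.toEquiv y)
  (Q.isoLeftDerivedObj (cosections _) i).hom ≫
    HomologicalComplex.homologyMap
      (((cosections _).mapHomologicalComplex _).map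
        (liftToResolution Q _ (restrictAugmentation (f ⁻¹' {y}) P)) ≫
      (NatTrans.mapHomologicalComplex (baseChange₀ f y) _).app P.complex) i ≫
    (((((lowerShriek f).mapHomologicalComplex _).obj P.complex).sc i).mapHomologyIso ev).hom ≫
    ev.map (P.isoLeftDerivedObj (lowerShriek f) i).inv

/-- Base change for homology holds for `f`: all base change morphisms are isomorphisms. -/
def SatisfiesHomologicalBaseChange (f : C(X, Y)) : Prop :=
  ∀ (F : AbData.{u, u} X) (y : Y) (i : ℕ), IsIso (baseChange f i F y)

end Homology

end

end FiniteSpace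

/-! Test everything on the projective generators `freeData x`: the constant data ℤ on the open set
U_x, extended by zero. As U_x ∩ S is open in S, H_i(S, `freeData x`) is H_i(U_x ∩ S, ℤ)
(`nonempty_homology_restrict_freeData_iso`). When f(x) ∈ C_y, the set U_x ∩ f⁻¹(C_y) has least
element x, so L(f⁻¹(C_y), `freeData x`) = ℤ; otherwise U_x misses f⁻¹(C_y) and everything vanishes.

Base change implies openness: `freeData x` is projective, so its L_i f_! is zero for i > 0, and for
i = 0 its value at y is ℤ. Base change carries this to the homology of U_x ∩ f⁻¹(y). Homologically
trivial fibers are nonempty, and nonempty fibers make f open.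

Openness implies base change: for a projective resolution P of F, the base change map factors
through L(f⁻¹(y), P). The map L(f⁻¹(y), P) → f_!P at y is an isomorphism in each degree, which
reduces to the generators and there to H_0 of a fiber being ℤ. The map from L(f⁻¹(y), Q) to
L(f⁻¹(y), P) is a quasi-isomorphism because the restrictions of projectives to f⁻¹(y) are acyclic,
which reduces to the vanishing of higher homology of the fibers. Acyclicity is expressed as
vanishing of Ext(-, R D) for D injective, where R is the right adjoint of L (constant data): Hom(L
M, D) = Hom(M, R D), and injectives detect quasi-isomorphisms (`isIso_homologyMap_of_acyclic`). -/

namespace CategoryTheory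

/-! ### Injective objects detect quasi-isomorphisms. -/

section DualityCriterion

variable {B : Type*} [Category* B] [Abelian B] [EnoughInjectives B]

/-- In an abelian category with enough injectives, a morphism of short complexes is a
quasi-isomorphism if it induces a bijection on the cohomology of `Hom(-, D)` for all
injective objects `D`. -/
theorem ShortComplex.isIso_homologyMap_of_injective {S₁ S₂ : ShortComplex B} (α : S₁ ⟶ S₂)
    (hs : ∀ (D : B) [Injective D] (g : S₁.X₂ ⟶ D), S₁.f ≫ g = 0 →
      ∃ (g' : S₂.X₂ ⟶ D) (h : S₁.X₃ ⟶ D), S₂.f ≫ g' = 0 ∧ g = α.τ₂ ≫ g' + S₁.g ≫ h)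
    (hi : ∀ (D : B) [Injective D] (g' : S₂.X₂ ⟶ D) (h : S₁.X₃ ⟶ D), S₂.f ≫ g' = 0 →
      α.τ₂ ≫ g' = S₁.g ≫ h → ∃ h' : S₂.X₃ ⟶ D, g' = S₂.g ≫ h') :
    IsIso (ShortComplex.homologyMap α) := by
  have : Mono (ShortComplex.homologyMap α) := by
    -- An embedding of the homology into an injective extends to a cocycle; lifting that cocycle
    -- along α factors the embedding through the map on homology.
    let a : S₁.homology ⟶ Injective.under S₁.homology := Injective.ι _
    let b : S₁.opcycles ⟶ Injective.under S₁.homology := Injective.factorThru a S₁.homologyι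
    have hb : S₁.homologyι ≫ b = a := Injective.comp_factorThru _ _
    obtain ⟨g', h, hg', hg⟩ := hs _ (S₁.pOpcycles ≫ b) (by simp)
    have key : ShortComplex.homologyMap α ≫ S₂.homologyι ≫ S₂.descOpcycles g' hg' = a := by
      rw [← cancel_epi S₁.homologyπ]
      have := S₁.iCycles ≫= hg
      rw [ShortComplex.homologyπ_naturality_assoc, ShortComplex.homology_π_ι_assoc,
        ShortComplex.p_descOpcycles, ShortComplex.cyclesMap_i_assoc]
      rw [← S₁.homology_π_ι_assoc, hb] at this
      simpa using this.symm
    have : Mono (ShortComplex.homologyMap α ≫ S₂.homologyι ≫ S₂.descOpcycles g' hg') := by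
      rw [key]; infer_instance
    exact mono_of_mono (ShortComplex.homologyMap α) (S₂.homologyι ≫ S₂.descOpcycles g' hg')
  have : Epi (ShortComplex.homologyMap α) := by
    rw [Preadditive.epi_iff_cancel_zero]
    intro A t ht
    rw [← cancel_mono (Injective.ι A), zero_comp]
    let b : S₂.opcycles ⟶ Injective.under A := Injective.factorThru (t ≫ Injective.ι A) S₂.homologyι
    have hb : S₂.homologyι ≫ b = t ≫ Injective.ι A := Injective.comp_factorThru _ _
    have hex : (ShortComplex.mk _ _ S₁.homologyι_comp_fromOpcycles).Exact :=
      ShortComplex.exact_of_f_is_kernel _ S₁.homologyIsKernel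
    obtain ⟨h, hh⟩ : ∃ h : S₁.X₃ ⟶ Injective.under A,
        S₁.fromOpcycles ≫ h = ShortComplex.opcyclesMap α ≫ b :=
      ⟨hex.descToInjective (ShortComplex.opcyclesMap α ≫ b) (by
        dsimp
        rw [← ShortComplex.homologyι_naturality_assoc, hb, reassoc_of% ht, zero_comp]),
        hex.comp_descToInjective _ _⟩
    -- The cocycle extending t becomes a coboundary on S₁, hence is one on S₂ and vanishes on
    -- homology.
    obtain ⟨h', hh'⟩ := hi _ (S₂.pOpcycles ≫ b) h (by simp) (by
      rw [← ShortComplex.p_opcyclesMap_assoc, ← hh, ShortComplex.p_fromOpcycles_assoc])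
    rw [← cancel_epi S₂.homologyπ, ← hb, ShortComplex.homology_π_ι_assoc, hh']
    simp
  exact isIso_of_mono_of_epi _

end DualityCriterion

/-! ### Comparison of resolutions by Ext-acyclic objects. -/

section AcyclicComparison

open Abelian

universe w

variable {A : Type*} [Category* A] [Abelian A]

/-- The sequence `opcycles (n + 1) ⟶ K.X n ⟶ opcycles n`. -/
noncomputable abbrev opcyclesShortComplex (K : ChainComplex A ℕ) (n : ℕ) : ShortComplex A :=
  ShortComplex.mk (K.fromOpcycles (n + 1) n) (K.pOpcycles n) (by
    rw [← cancel_epi (K.pOpcycles (n + 1))]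
    simp)

/-- In a resolution the opcycles are the successive syzygies; these sequences are the ones used for
dimension shifting. -/
theorem opcyclesShortComplex_shortExact (K : ChainComplex A ℕ) (n : ℕ)
    (h : K.ExactAt (n + 1)) : (opcyclesShortComplex K n).ShortExact := by
  have hf : Mono (opcyclesShortComplex K n).f := by
    have hk := K.homologyIsKernel (n + 1) n (by simp)
    have hz : K.homologyι (n + 1) = 0 := h.isZero_homology.eq_of_src _ _
    refine Preadditive.mono_of_cancel_zero _ fun {T} t ht => ?_
    have := KernelFork.IsLimit.lift' hk t ht
    rw [← this.2]
    exact (congrArg (this.1 ≫ ·) hz).trans comp_zero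
  have hg : Epi (opcyclesShortComplex K n).g :=
    inferInstanceAs (Epi (K.pOpcycles n))
  refine ⟨ShortComplex.exact_of_g_is_cokernel _ ?_⟩
  refine CokernelCofork.IsColimit.ofπ' _ _ fun {T} t ht => ?_
  refine ⟨K.descOpcycles t (n + 1) (by simp) ?_, K.p_descOpcycles _ _ _ _⟩
  rw [← K.p_fromOpcycles]
  exact (Category.assoc _ _ _).trans ((K.pOpcycles (n + 1) ≫= ht).trans comp_zero)

/-- The morphism of sequences `opcyclesShortComplex` induced by a chain map. -/
noncomputable abbrev opcyclesShortComplexMap {Q K : ChainComplex A ℕ} (φ : Q ⟶ K) (n : ℕ) :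
    opcyclesShortComplex Q n ⟶ opcyclesShortComplex K n where
  τ₁ := HomologicalComplex.opcyclesMap φ (n + 1)
  τ₂ := φ.f n
  τ₃ := HomologicalComplex.opcyclesMap φ n
  comm₁₂ := by
    dsimp [opcyclesShortComplex]
    rw [← cancel_epi (Q.pOpcycles (n + 1))]
    simp
  comm₂₃ := by
    dsimp [opcyclesShortComplex]
    simp

variable [HasExt.{w} A]

section

variable {S₁ S₂ : ShortComplex A} (h₁ : S₁.ShortExact) (h₂ : S₂.ShortExact) (α : S₁ ⟶ S₂) (E : A)

theorem ShortComplex.ShortExact.extClass_comp_precomp {j : ℕ} (x : Ext.{w} S₂.X₁ E j)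
    {m : ℕ} (hm : 1 + j = m) :
    h₁.extClass.comp ((Ext.mk₀ α.τ₁).comp x (zero_add j)) hm =
      (Ext.mk₀ α.τ₃).comp (h₂.extClass.comp x hm) (zero_add m) := by
  have h2 := congrArg (fun z => Ext.comp z x hm)
    (ShortComplex.ShortExact.extClass_naturality h₁ h₂ α)
  rw [Ext.comp_assoc _ _ _ (add_zero 1) (zero_add j) (by omega),
    Ext.comp_assoc _ _ _ (zero_add 1) hm (by omega)] at h2
  exact h2

include h₁ h₂

/-- Surjective half of a four lemma for the two long exact Ext sequences. The correction z is kept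
because j = 0 is allowed: there it becomes the coboundary, while for j > 0 acyclicity kills it. -/
theorem ShortComplex.ShortExact.exists_ext_eq_add {j : ℕ}
    (hs : Function.Surjective fun x : Ext.{w} S₂.X₃ E (j + 1) =>
      (Ext.mk₀ α.τ₃).comp x (zero_add _))
    (hE : Subsingleton (Ext.{w} S₂.X₂ E (j + 1))) (y : Ext.{w} S₁.X₁ E j) :
    ∃ (x : Ext.{w} S₂.X₁ E j) (z : Ext.{w} S₁.X₂ E j),
      y = (Ext.mk₀ α.τ₁).comp x (zero_add j) + (Ext.mk₀ S₁.f).comp z (zero_add j) := by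
  obtain ⟨w, hw⟩ := hs (h₁.extClass.comp y (add_comm 1 j))
  obtain ⟨x, rfl⟩ := Ext.contravariant_sequence_exact₃ h₂ E w (hE.elim _ _) (add_comm 1 j)
  obtain ⟨z, hz⟩ := Ext.contravariant_sequence_exact₁ h₁ E
    (y - (Ext.mk₀ α.τ₁).comp x (zero_add j)) (add_comm 1 j) (by
      rw [sub_eq_add_neg, Ext.comp_add, Ext.comp_neg, h₁.extClass_comp_precomp h₂ α, ← hw,
        add_neg_cancel])
  exact ⟨x, z, by rw [hz, add_sub_cancel]⟩

theorem ShortComplex.ShortExact.exists_ext_eq_comp {j : ℕ}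
    (hi : Function.Injective fun x : Ext.{w} S₂.X₃ E (j + 1) =>
      (Ext.mk₀ α.τ₃).comp x (zero_add _))
    (x : Ext.{w} S₂.X₁ E j) (z : Ext.{w} S₁.X₂ E j)
    (hx : (Ext.mk₀ α.τ₁).comp x (zero_add j) = (Ext.mk₀ S₁.f).comp z (zero_add j)) :
    ∃ z' : Ext.{w} S₂.X₂ E j, x = (Ext.mk₀ S₂.f).comp z' (zero_add j) := by
  have := h₁.extClass_comp_precomp h₂ α E x (add_comm 1 j)
  rw [hx, h₁.extClass_comp_assoc] at this
  obtain ⟨z', hz'⟩ := Ext.contravariant_sequence_exact₁ h₂ E x (add_comm 1 j) (hi (by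
    dsimp only
    rw [← this, Ext.comp_zero]))
  exact ⟨z', hz'.symm⟩

end

section

variable {Q K : ChainComplex A ℕ} (φ : Q ⟶ K) (E : A)
  (hQ : ∀ n, Q.ExactAt (n + 1)) (hK : ∀ n, K.ExactAt (n + 1))
  (hQE : ∀ n j, Subsingleton (Ext.{w} (Q.X n) E (j + 1)))
  (hKE : ∀ n j, Subsingleton (Ext.{w} (K.X n) E (j + 1)))

include hQ hK hQE hKE

/-- Dimension shifting: by acyclicity Ext^(j+1) of the syzygy n + 1 is Ext^(j+2) of the syzygy n, so
all degrees j are carried through the induction down to n = 0, where φ is an isomorphism on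
opcycles. -/
theorem ext_opcyclesMap_bijective [IsIso (HomologicalComplex.opcyclesMap φ 0)] (n j : ℕ) :
    Function.Bijective fun x : Ext.{w} (K.opcycles n) E (j + 1) =>
      (Ext.mk₀ (HomologicalComplex.opcyclesMap φ n)).comp x (zero_add _) := by
  induction n generalizing j with
  | zero =>
    refine Function.bijective_iff_has_inverse.2 ⟨fun x =>
      (Ext.mk₀ (inv (HomologicalComplex.opcyclesMap φ 0))).comp x (zero_add _), fun x => ?_,
      fun x => ?_⟩ <;> simp
  | succ n ih =>
    have eQ := opcyclesShortComplex_shortExact Q n (hQ n)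
    have eK := opcyclesShortComplex_shortExact K n (hK n)
    constructor
    · intro x y hxy
      rw [← sub_eq_zero]
      obtain ⟨z', hz'⟩ := eQ.exists_ext_eq_comp eK (opcyclesShortComplexMap φ n) E
        (ih (j + 1)).1 (x - y) 0 (by
          rw [Ext.comp_zero, sub_eq_add_neg, Ext.comp_add, Ext.comp_neg, ← sub_eq_add_neg,
            sub_eq_zero]
          exact hxy)
      rw [hz', (hKE n j).elim z' 0, Ext.comp_zero]
    · intro y
      obtain ⟨x, z, h⟩ := eQ.exists_ext_eq_add eK (opcyclesShortComplexMap φ n) E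
        (ih (j + 1)).2 (hKE n (j + 1)) y
      refine ⟨x, ?_⟩
      rw [h, (hQE n j).elim z 0, Ext.comp_zero, add_zero]

/-- Let `φ : Q ⟶ K` be a morphism between resolutions of the same object whose terms have no
higher extensions by `E`. Then every cocycle of `Hom(Q, E)` comes from a cocycle of `Hom(K, E)`
up to a coboundary. -/
theorem exists_cocycle_eq_add [IsIso (HomologicalComplex.opcyclesMap φ 0)] (n : ℕ)
    (g : Q.X (n + 1) ⟶ E) (hg : Q.d (n + 2) (n + 1) ≫ g = 0) :
    ∃ (g' : K.X (n + 1) ⟶ E) (h : Q.X n ⟶ E), K.d (n + 2) (n + 1) ≫ g' = 0 ∧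
      g = φ.f (n + 1) ≫ g' + Q.d (n + 1) n ≫ h := by
  -- A cocycle in degree n + 1 is a morphism out of the opcycles, that is a class in Ext⁰; it is a
  -- coboundary when it extends along `fromOpcycles`.
  obtain ⟨x, z, h⟩ := (opcyclesShortComplex_shortExact Q n (hQ n)).exists_ext_eq_add
    (opcyclesShortComplex_shortExact K n (hK n)) (opcyclesShortComplexMap φ n) E
    (ext_opcyclesMap_bijective φ E hQ hK hQE hKE n 0).2 (hKE n 0)
    (Ext.mk₀ (Q.descOpcycles g (n + 2) (by simp) hg))
  obtain ⟨x, rfl⟩ := (Ext.mk₀_bijective _ _).2 x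
  obtain ⟨z, rfl⟩ := (Ext.mk₀_bijective _ _).2 z
  rw [Ext.mk₀_comp_mk₀, Ext.mk₀_comp_mk₀, ← Ext.mk₀_add] at h
  have h := (Ext.mk₀_bijective _ _).1 h
  have h' : Q.descOpcycles g (n + 2) (by simp) hg =
    HomologicalComplex.opcyclesMap φ (n + 1) ≫ x + Q.fromOpcycles (n + 1) n ≫ z := h
  refine ⟨K.pOpcycles (n + 1) ≫ (x : K.opcycles (n + 1) ⟶ E), z, ?_, ?_⟩
  · rw [HomologicalComplex.d_pOpcycles_assoc, zero_comp]
  · have := Q.pOpcycles (n + 1) ≫= h'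
    simpa using this

/-- The injective half, companion to `exists_cocycle_eq_add`. -/
theorem exists_eq_coboundary [IsIso (HomologicalComplex.opcyclesMap φ 0)] (n : ℕ)
    (g' : K.X (n + 1) ⟶ E) (h : Q.X n ⟶ E) (hg' : K.d (n + 2) (n + 1) ≫ g' = 0)
    (hh : φ.f (n + 1) ≫ g' = Q.d (n + 1) n ≫ h) :
    ∃ h' : K.X n ⟶ E, g' = K.d (n + 1) n ≫ h' := by
  obtain ⟨z, hz⟩ := (opcyclesShortComplex_shortExact Q n (hQ n)).exists_ext_eq_comp
    (opcyclesShortComplex_shortExact K n (hK n)) (opcyclesShortComplexMap φ n) E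
    (ext_opcyclesMap_bijective φ E hQ hK hQE hKE n 0).1
    (Ext.mk₀ (K.descOpcycles g' (n + 2) (by simp) hg')) (Ext.mk₀ h) (by
      rw [Ext.mk₀_comp_mk₀, Ext.mk₀_comp_mk₀]
      congr 1
      change HomologicalComplex.opcyclesMap φ (n + 1) ≫ K.descOpcycles g' (n + 2) (by simp) hg' =
        Q.fromOpcycles (n + 1) n ≫ h
      rw [← cancel_epi (Q.pOpcycles (n + 1))]
      simpa using hh)
  obtain ⟨z, rfl⟩ := (Ext.mk₀_bijective _ _).2 z
  rw [Ext.mk₀_comp_mk₀] at hz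
  have h' : K.descOpcycles g' (n + 2) (by simp) hg' = K.fromOpcycles (n + 1) n ≫ z :=
    (Ext.mk₀_bijective _ _).1 hz
  refine ⟨z, ?_⟩
  have := K.pOpcycles (n + 1) ≫= h'
  simpa using this

end

/-- A functor `G` with right adjoint `R` sends a morphism between resolutions with terms acyclic
for `Ext(-, R D)`, `D` injective, to a quasi-isomorphism. -/
theorem isIso_homologyMap_of_acyclic {B : Type*} [Category* B] [Abelian B] [EnoughInjectives B]
    {G : A ⥤ B} [G.Additive] {R : B ⥤ A} (adj : G ⊣ R) {Q K : ChainComplex A ℕ} (φ : Q ⟶ K)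
    [IsIso (HomologicalComplex.opcyclesMap φ 0)]
    (hQ : ∀ n, Q.ExactAt (n + 1)) (hK : ∀ n, K.ExactAt (n + 1))
    (hQE : ∀ (D : B) [Injective D] (n j), Subsingleton (Ext.{w} (Q.X n) (R.obj D) (j + 1)))
    (hKE : ∀ (D : B) [Injective D] (n j), Subsingleton (Ext.{w} (K.X n) (R.obj D) (j + 1)))
    (i : ℕ) :
    IsIso (HomologicalComplex.homologyMap ((G.mapHomologicalComplex _).map φ) i) := by
  have hc {M N : A} {D : B} (f : M ⟶ N) (g : G.obj N ⟶ D) :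
      adj.homEquiv _ _ (G.map f ≫ g) = f ≫ adj.homEquiv _ _ g := adj.homEquiv_naturality_left f g
  have hadd {M : A} {D : B} (a b : G.obj M ⟶ D) :
      adj.homEquiv _ _ (a + b) = adj.homEquiv _ _ a + adj.homEquiv _ _ b := by
    have := adj.right_adjoint_additive
    simp [Adjunction.homEquiv_unit]
  have hzero {M : A} {D : B} : adj.homEquiv _ _ (0 : G.obj M ⟶ D) = 0 := by
    have := adj.right_adjoint_additive
    simp [Adjunction.homEquiv_unit]
  -- Through the adjunction, the duality criterion for G φ becomes a statement about Hom(-, R D)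
  -- before applying G.
  have key (k : ℕ) (hk : (ComplexShape.down ℕ).next i = k)
      (hs : ∀ (D : B) [Injective D] (g : Q.X i ⟶ R.obj D), Q.d (i + 1) i ≫ g = 0 →
        ∃ (g' : K.X i ⟶ R.obj D) (h : Q.X k ⟶ R.obj D),
          K.d (i + 1) i ≫ g' = 0 ∧ g = φ.f i ≫ g' + Q.d i k ≫ h)
      (hi : ∀ (D : B) [Injective D] (g' : K.X i ⟶ R.obj D) (h : Q.X k ⟶ R.obj D),
        K.d (i + 1) i ≫ g' = 0 → φ.f i ≫ g' = Q.d i k ≫ h →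
        ∃ h' : K.X k ⟶ R.obj D, g' = K.d i k ≫ h') :
      IsIso (HomologicalComplex.homologyMap ((G.mapHomologicalComplex _).map φ) i) := by
    have e := HomologicalComplex.homologyFunctorIso' B (ComplexShape.down ℕ) (i + 1) i k
      (by simp) hk
    refine (NatIso.isIso_map_iff e ((G.mapHomologicalComplex _).map φ)).2 ?_
    refine ShortComplex.isIso_homologyMap_of_injective _ ?_ ?_
    · intro D _ g hg
      change G.obj (Q.X i) ⟶ D at g
      have hg : G.map (Q.d (i + 1) i) ≫ g = 0 := hg
      obtain ⟨g', h, h1, h2⟩ := hs D (adj.homEquiv _ _ g) (by rw [← hc, hg, hzero])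
      obtain ⟨g', rfl⟩ := (adj.homEquiv _ _).surjective g'
      obtain ⟨h, rfl⟩ := (adj.homEquiv _ _).surjective h
      refine ⟨g', h, (adj.homEquiv _ _).injective ?_, (adj.homEquiv _ _).injective ?_⟩
      · exact (hc _ _).trans (h1.trans hzero.symm)
      · rw [h2, ← hc, ← hc, ← hadd]
        rfl
    · intro D _ g' h hg' hh
      change G.obj (K.X i) ⟶ D at g'
      change G.obj (Q.X k) ⟶ D at h
      have hg' : G.map (K.d (i + 1) i) ≫ g' = 0 := hg'
      have hh : G.map (φ.f i) ≫ g' = G.map (Q.d i k) ≫ h := hh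
      obtain ⟨h', h1⟩ := hi D (adj.homEquiv _ _ g') (adj.homEquiv _ _ h)
        (by rw [← hc, hg', hzero]) (by rw [← hc, ← hc, hh])
      obtain ⟨h', rfl⟩ := (adj.homEquiv _ _).surjective h'
      exact ⟨h', (adj.homEquiv _ _).injective (h1.trans (hc _ _).symm)⟩
  cases i with
  | zero =>
    -- No degree follows 0, so `next` takes its default value 0 and the differential is `d 0 0 = 0`.
    -- Cocycles are then morphisms out of `opcycles 0`, where φ is invertible.
    refine key 0 (by simp) ?_ ?_
    · intro D _ g hg
      refine ⟨K.pOpcycles 0 ≫ inv (HomologicalComplex.opcyclesMap φ 0) ≫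
        Q.descOpcycles g 1 (by simp) hg, 0, by simp, ?_⟩
      rw [← HomologicalComplex.p_opcyclesMap_assoc]
      simp
    · intro D _ g' h hg' hh
      refine ⟨0, ?_⟩
      have h0 : Q.d 0 0 = 0 := Q.shape _ _ (by simp)
      have hz : HomologicalComplex.opcyclesMap φ 0 ≫ K.descOpcycles g' 1 (by simp) hg' = 0 := by
        rw [← cancel_epi (Q.pOpcycles 0)]
        simpa [h0] using hh
      rw [← K.p_descOpcycles g' 1 (by simp) hg', (cancel_epi _).1 (hz.trans comp_zero.symm)]
      simp
  | succ n =>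
    refine key n (by simp) ?_ ?_
    · intro D _ g hg
      exact exists_cocycle_eq_add φ _ hQ hK (hQE D) (hKE D) n g hg
    · intro D _ g' h hg' hh
      exact exists_eq_coboundary φ _ hQ hK (hQE D) (hKE D) n g' h hg' hh

/-- Vanishing of the left derived functors of a left adjoint `G ⊣ R` implies the vanishing of
extensions by `R D`, for `D` injective. -/
theorem subsingleton_ext_of_isZero_leftDerived {B : Type*} [Category* B] [Abelian B]
    [HasProjectiveResolutions A] {G : A ⥤ B} [G.Additive] {R : B ⥤ A} (adj : G ⊣ R) (F : A) (n : ℕ)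
    (h : IsZero ((G.leftDerived (n + 1)).obj F)) (D : B) [Injective D] :
    Subsingleton (Ext.{w} F (R.obj D) (n + 1)) := by
  let P := projectiveResolution F
  have hex : ((G.mapHomologicalComplex _).obj P.complex).ExactAt (n + 1) := by
    rw [HomologicalComplex.exactAt_iff_isZero_homology]
    exact h.of_iso (P.isoLeftDerivedObj G (n + 1)).symm
  rw [HomologicalComplex.exactAt_iff' _ (n + 2) (n + 1) n (by simp) (by simp)] at hex
  refine subsingleton_of_forall_eq 0 fun α => ?_
  obtain ⟨g, hg, rfl⟩ := P.extMk_surjective α (n + 2) rfl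
  rw [P.extMk_eq_zero_iff _ _ _ _ n rfl]
  obtain ⟨g, rfl⟩ := (adj.homEquiv _ _).surjective g
  have hg' : G.map (P.complex.d (n + 2) (n + 1)) ≫ g = 0 := by
    have := adj.right_adjoint_additive
    apply (adj.homEquiv _ _).injective
    rw [adj.homEquiv_naturality_left, hg]
    simp [Adjunction.homEquiv_unit]
  -- The transposed cocycle kills boundaries, so by exactness and injectivity of D it extends over
  -- the next differential.
  exact ⟨adj.homEquiv _ _ (hex.descToInjective g hg'),
    (adj.homEquiv_naturality_left _ _).symm.trans
      (congrArg _ (hex.comp_descToInjective g hg'))⟩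

omit [HasExt.{w} A] in
/-- Exactness of a short complex of functors can be checked pointwise. -/
theorem ShortComplex.exact_of_evaluation {J : Type*} [Category* J] (S : ShortComplex (J ⥤ A))
    (h : ∀ j, (S.map ((evaluation J A).obj j)).Exact) : S.Exact := by
  rw [ShortComplex.exact_iff_isZero_homology, Functor.isZero_iff]
  intro j
  exact ((ShortComplex.exact_iff_isZero_homology _).1 (h j)).of_iso
    (S.mapHomologyIso ((evaluation J A).obj j)).symm

omit [HasExt.{w} A] in
theorem ShortComplex.ShortExact.sigma {σ : Type*} [HasColimitsOfShape (Discrete σ) A]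
    [HasExactColimitsOfShape (Discrete σ) A] {S : σ → ShortComplex A}
    (hS : ∀ s, (S s).ShortExact) :
    (ShortComplex.mk (Limits.Sigma.map fun s => (S s).f) (Limits.Sigma.map fun s => (S s).g)
      (by ext s; simp)).ShortExact := by
  let S' : ShortComplex (Discrete σ ⥤ A) := ShortComplex.mk
    (Discrete.natTrans (F := Discrete.functor fun s => (S s).X₁)
      (G := Discrete.functor fun s => (S s).X₂) fun s => (S s.as).f)
    (Discrete.natTrans (G := Discrete.functor fun s => (S s).X₃) fun s => (S s.as).g)
    (by ext s; exact (S s.as).zero)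
  have hS' : S'.ShortExact :=
    { exact := ShortComplex.exact_of_evaluation _ fun s => (hS s.as).exact
      mono_f := by
        rw [NatTrans.mono_iff_mono_app]
        exact fun s => (hS s.as).mono_f
      epi_g := by
        rw [NatTrans.epi_iff_epi_app]
        exact fun s => (hS s.as).epi_g }
  exact hS'.map_of_exact colim

omit [Abelian A] [HasExt.{w} A] in
theorem projective_sigma {σ : Type*} (P : σ → A) [HasCoproduct P] (h : ∀ s, Projective (P s)) :
    Projective (∐ P) where
  factors {E X} f e _ :=
    ⟨Limits.Sigma.desc fun s => Projective.factorThru (Sigma.ι P s ≫ f) e, by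
      refine Limits.Sigma.hom_ext _ _ fun s => ?_
      simp⟩

/-- Extensions of a coproduct vanish if those of the summands do. -/
theorem subsingleton_ext_sigma [EnoughProjectives A] {σ : Type*} [HasColimitsOfShape (Discrete σ) A]
    [HasExactColimitsOfShape (Discrete σ) A] (E : A) (n : ℕ) (F : σ → A)
    (h : ∀ s, Subsingleton (Ext.{w} (F s) E (n + 1))) :
    Subsingleton (Ext.{w} (∐ F) E (n + 1)) := by
  have key (F : σ → A) : ∃ S : σ → ShortComplex A, (∀ s, (S s).ShortExact) ∧
      (∀ s, Projective (S s).X₂) ∧ F = fun s => (S s).X₃ :=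
    ⟨fun s => ShortComplex.mk (kernel.ι (Projective.π (F s))) (Projective.π (F s))
      (kernel.condition _), fun s =>
        { exact := ShortComplex.exact_of_f_is_kernel _ (kernelIsKernel _) },
      fun s => inferInstance, rfl⟩
  -- Dimension shifting along a coproduct of projective presentations. In degree 1 a class is
  -- represented by a morphism out of the coproduct of kernels; each component extends over its
  -- projective, and the extensions assemble.
  induction n generalizing F with
  | zero =>
    obtain ⟨S, hS, hp, rfl⟩ := key F
    have hP := projective_sigma (fun s => (S s).X₂) hp
    have hx (m : ℕ) (x : Ext.{w} (∐ fun s => (S s).X₂) E (m + 1)) : x = 0 :=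
      Ext.eq_zero_of_projective x
    refine subsingleton_of_forall_eq 0 fun x => ?_
    obtain ⟨y, rfl⟩ := Ext.contravariant_sequence_exact₃ (ShortComplex.ShortExact.sigma hS) E x
      (hx _ _) (add_zero 1)
    obtain ⟨y, rfl⟩ := (Ext.mk₀_bijective _ _).2 y
    have hex (s : σ) : ∃ z : (S s).X₂ ⟶ E,
        (S s).f ≫ z = Sigma.ι (fun s => (S s).X₁) s ≫ y := by
      obtain ⟨z, hz⟩ := Ext.contravariant_sequence_exact₁ (hS s) E
        (Ext.mk₀ (Sigma.ι (fun s => (S s).X₁) s ≫ y)) (add_zero 1) ((h s).elim _ _)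
      obtain ⟨z, rfl⟩ := (Ext.mk₀_bijective _ _).2 z
      rw [Ext.mk₀_comp_mk₀] at hz
      exact ⟨z, (Ext.mk₀_bijective _ _).1 hz⟩
    choose z hz using hex
    have : y = Limits.Sigma.map (fun s => (S s).f) ≫ Limits.Sigma.desc z := by
      refine Limits.Sigma.hom_ext _ _ fun s => ?_
      simp [hz]
    rw [this, ← Ext.mk₀_comp_mk₀, (ShortComplex.ShortExact.sigma hS).extClass_comp_assoc]
  | succ n ih =>
    obtain ⟨S, hS, hp, rfl⟩ := key F
    have hP := projective_sigma (fun s => (S s).X₂) hp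
    have hx (m : ℕ) (x : Ext.{w} (∐ fun s => (S s).X₂) E (m + 1)) : x = 0 :=
      Ext.eq_zero_of_projective x
    refine subsingleton_of_forall_eq 0 fun x => ?_
    obtain ⟨y, rfl⟩ := Ext.contravariant_sequence_exact₃ (ShortComplex.ShortExact.sigma hS) E x
      (hx _ _) (add_comm 1 (n + 1))
    have : Subsingleton (Ext.{w} (∐ fun s => (S s).X₁) E (n + 1)) := by
      refine ih _ fun s => subsingleton_of_forall_eq 0 fun t => ?_
      obtain ⟨t', rfl⟩ := Ext.contravariant_sequence_exact₁ (hS s) E t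
        (add_comm 1 (n + 1)) ((h s).elim _ _)
      have := hp s
      rw [Ext.eq_zero_of_projective t', Ext.comp_zero]
    rw [this.elim y 0, Ext.comp_zero]

/-- Extensions of a retract vanish if those of the ambient object do. -/
theorem subsingleton_ext_of_retract {M N : A} (r : Retract M N) (E : A) (n : ℕ)
    (h : Subsingleton (Ext.{w} N E n)) : Subsingleton (Ext.{w} M E n) := by
  refine subsingleton_of_forall_eq 0 fun x => ?_
  rw [← Ext.mk₀_id_comp x, ← r.retract, ← Ext.mk₀_comp_mk₀_assoc,
    h.elim ((Ext.mk₀ r.r).comp x (zero_add n)) 0, Ext.comp_zero]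

end AcyclicComparison

end CategoryTheory

namespace CategoryTheory

section DerivedTransport

variable {A A' B : Type*} [Category* A] [Category* A'] [Category* B] [Abelian A] [Abelian A']
  [Abelian B] [HasProjectiveResolutions A] [HasProjectiveResolutions A']

/-- Such an F carries projective resolutions to projective resolutions. -/
theorem nonempty_leftDerived_obj_iso (F : A ⥤ A') [F.Additive] [F.PreservesHomology]
    [F.PreservesProjectiveObjects] {G' : A' ⥤ B} [G'.Additive] {G : A ⥤ B} [G.Additive]
    (e : F ⋙ G' ≅ G) (n : ℕ) (Z : A) :
    Nonempty ((G'.leftDerived n).obj (F.obj Z) ≅ (G.leftDerived n).obj Z) := by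
  let P := projectiveResolution Z
  refine ⟨(F.mapProjectiveResolution P).isoLeftDerivedObj G' n ≪≫ ?_ ≪≫
    (P.isoLeftDerivedObj G n).symm⟩
  refine (HomologicalComplex.homologyFunctor B _ n).mapIso ?_
  exact (NatIso.mapHomologicalComplex e _).app P.complex

end DerivedTransport

/-! ### Extension by zero as a left Kan extension. -/

section ExtensionByZero

variable {J J' : Type u} [SmallCategory J] [SmallCategory J'] (k : J ⥤ J')

theorem isZero_lan_obj (G : J ⥤ AddCommGrpCat.{u}) (s : J')
    (hs : ∀ t, IsEmpty (k.obj t ⟶ s)) : IsZero ((k.lan.obj G).obj s) := by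
  have hc := Functor.isPointwiseLeftKanExtensionLeftKanExtensionUnit k G s
  rw [IsZero.iff_id_eq_zero]
  refine hc.hom_ext fun j => ?_
  exact ((hs j.left).false j.hom).elim

instance : (k.lan : (J ⥤ AddCommGrpCat.{u}) ⥤ (J' ⥤ AddCommGrpCat.{u})).Additive :=
  (k.lanAdjunction AddCommGrpCat.{u}).left_adjoint_additive

variable [k.Full] [k.Faithful] (hk : ∀ s, s ∈ Set.range k.obj ∨ ∀ t, IsEmpty (k.obj t ⟶ s))

include hk

/-- By `hk` no arrow leaves the image of `k`, so the Kan extension keeps the values on the image and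
is zero elsewhere. -/
theorem lan_preservesMonomorphisms :
    (k.lan : (J ⥤ AddCommGrpCat.{u}) ⥤ _).PreservesMonomorphisms where
  preserves {G G'} φ _ := by
    rw [NatTrans.mono_iff_mono_app]
    intro s
    rcases hk s with ⟨t, rfl⟩ | h
    · have e : (k.lanUnit.app G).app t ≫ (k.lan.map φ).app (k.obj t) =
          φ.app t ≫ (k.lanUnit.app G').app t :=
        (NatTrans.congr_app (k.lanUnit.naturality φ) t).symm
      have : (k.lan.map φ).app (k.obj t) =
          inv ((k.lanUnit.app G).app t) ≫ φ.app t ≫ (k.lanUnit.app G').app t := by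
        rw [← e, IsIso.inv_hom_id_assoc]
      rw [this]
      have : Mono (φ.app t) := (NatTrans.mono_iff_mono_app φ).1 inferInstance t
      infer_instance
    · exact ⟨fun _ _ _ => (isZero_lan_obj k G s h).eq_of_tgt _ _⟩

theorem lan_preservesHomology :
    (k.lan : (J ⥤ AddCommGrpCat.{u}) ⥤ (J' ⥤ AddCommGrpCat.{u})).PreservesHomology := by
  have := lan_preservesMonomorphisms k hk
  have := (k.lanAdjunction AddCommGrpCat.{u}).isLeftAdjoint
  exact Functor.preservesHomology_of_preservesMonos_and_cokernels _

theorem isIso_lan_counit_app (F : J' ⥤ AddCommGrpCat.{u})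
    (hF : ∀ s, s ∉ Set.range k.obj → IsZero (F.obj s)) :
    IsIso ((k.lanAdjunction AddCommGrpCat.{u}).counit.app F) := by
  rw [NatTrans.isIso_iff_isIso_app]
  intro s
  by_cases hs : s ∈ Set.range k.obj
  · obtain ⟨t, rfl⟩ := hs
    have := NatTrans.congr_app ((k.lanAdjunction AddCommGrpCat.{u}).right_triangle_components F) t
    have h2 : ((k.lanAdjunction AddCommGrpCat.{u}).unit.app (k ⋙ F)).app t ≫
      ((k.lanAdjunction AddCommGrpCat.{u}).counit.app F).app (k.obj t) = 𝟙 _ := this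
    exact IsIso.of_isIso_fac_left h2
  · have h := (hk s).resolve_left hs
    exact ⟨0, (isZero_lan_obj k _ s h).eq_of_src _ _, (hF s hs).eq_of_src _ _⟩

/-- Extension by zero is exact, preserves projectives (its right adjoint is exact) and commutes with
colimits; F is the extension by zero of its restriction. -/
theorem nonempty_leftDerived_colim_iso (F : J' ⥤ AddCommGrpCat.{u})
    (hF : ∀ s, s ∉ Set.range k.obj → IsZero (F.obj s)) (n : ℕ) :
    Nonempty (((colim : (J' ⥤ AddCommGrpCat.{u}) ⥤ _).leftDerived n).obj F ≅
      ((colim : (J ⥤ AddCommGrpCat.{u}) ⥤ _).leftDerived n).obj (k ⋙ F)) := by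
  have := lan_preservesHomology k hk
  have := isIso_lan_counit_app k hk F hF
  have : (k.lan : (J ⥤ AddCommGrpCat.{u}) ⥤ _).PreservesProjectiveObjects :=
    Functor.preservesProjectiveObjects_of_adjunction_of_preservesEpimorphisms
      (k.lanAdjunction AddCommGrpCat.{u})
  have e : (k.lan : (J ⥤ AddCommGrpCat.{u}) ⥤ _) ⋙ colim ≅ colim :=
    ((k.lanAdjunction AddCommGrpCat.{u}).comp colimConstAdj).leftAdjointUniq colimConstAdj
  obtain ⟨e'⟩ := nonempty_leftDerived_obj_iso k.lan e n (k ⋙ F)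
  exact ⟨(colim.leftDerived n).mapIso
    (asIso ((k.lanAdjunction AddCommGrpCat.{u}).counit.app F)).symm ≪≫ e'⟩

end ExtensionByZero

/-! ### Free functors as projective generators. -/

section EnoughFree

variable {J : Type u} [SmallCategory J]

/-- The functor `j ↦ ⨁_{x ⟶ j} ℤ`. -/
noncomputable abbrev freeFunctor (x : J) : J ⥤ AddCommGrpCat.{u} :=
  (evaluationLeftAdjoint AddCommGrpCat.{u} x).obj (AddCommGrpCat.of (ULift.{u} ℤ))

instance : Projective (AddCommGrpCat.of (ULift.{u} ℤ)) where
  factors {E X} f e _ := by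
    obtain ⟨a, ha⟩ := (AddCommGrpCat.epi_iff_surjective e).1 inferInstance (f ⟨1⟩)
    refine ⟨AddCommGrpCat.ofHom
      ((zmultiplesHom E a).comp (AddEquiv.ulift (α := ℤ)).toAddMonoidHom), ?_⟩
    ext ⟨z⟩
    change e (z • a) = f ⟨z⟩
    rw [map_zsmul, ha, ← map_zsmul]
    congr 1
    exact ULift.ext _ _ (by simp)

instance (x : J) : Projective (freeFunctor x) :=
  (evaluationAdjunctionRight AddCommGrpCat.{u} x).map_projective _ inferInstance

/-- Every functor to abelian groups is a quotient of a coproduct of functors `freeFunctor x`. -/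
theorem exists_epi_sigma_freeFunctor (F : J ⥤ AddCommGrpCat.{u}) :
    ∃ (σ : Type u) (x : σ → J) (p : (∐ fun s => freeFunctor (x s)) ⟶ F), Epi p := by
  let g (s : Σ j : J, F.obj j) : AddCommGrpCat.of (ULift.{u} ℤ) ⟶ F.obj s.1 :=
    AddCommGrpCat.ofHom ((zmultiplesHom (F.obj s.1) s.2).comp
      (AddEquiv.ulift (α := ℤ)).toAddMonoidHom)
  let p : (∐ fun s : Σ j : J, F.obj j => freeFunctor s.1) ⟶ F :=
    Limits.Sigma.desc fun s =>
      ((evaluationAdjunctionRight AddCommGrpCat.{u} s.1).homEquiv _ _).symm (g s)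
  refine ⟨_, _, p, ?_⟩
  rw [NatTrans.epi_iff_epi_app]
  intro j
  rw [AddCommGrpCat.epi_iff_surjective]
  intro a
  have h1 : Sigma.ι (fun s : Σ j : J, F.obj j => freeFunctor s.1) ⟨j, a⟩ ≫ p =
    ((evaluationAdjunctionRight AddCommGrpCat.{u} j).homEquiv _ _).symm (g ⟨j, a⟩) :=
    Limits.Sigma.ι_desc _ _
  have h2 := (evaluationAdjunctionRight AddCommGrpCat.{u} j).homEquiv_naturality_right
    (Sigma.ι (fun s : Σ j : J, F.obj j => freeFunctor s.1) ⟨j, a⟩) p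
  rw [h1, Equiv.apply_symm_apply] at h2
  have h3 : g ⟨j, a⟩ ⟨1⟩ = a := one_zsmul a
  rw [h2] at h3
  exact ⟨_, h3⟩

theorem exists_retract_sigma_freeFunctor (P : J ⥤ AddCommGrpCat.{u}) [Projective P] :
    ∃ (σ : Type u) (x : σ → J), Nonempty (Retract P (∐ fun s => freeFunctor (x s))) := by
  obtain ⟨σ, x, p, _⟩ := exists_epi_sigma_freeFunctor P
  exact ⟨σ, x, ⟨⟨Projective.factorThru (𝟙 P) p, p, Projective.factorThru_comp _ _⟩⟩⟩

/-- A natural transformation between coproduct preserving functors is an isomorphism on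
projective objects if it is so on the functors `freeFunctor x`. -/
theorem isIso_app_of_projective {B : Type*} [Category* B] {U V : (J ⥤ AddCommGrpCat.{u}) ⥤ B}
    (hU : ∀ σ : Type u, PreservesColimitsOfShape (Discrete σ) U)
    (hV : ∀ σ : Type u, PreservesColimitsOfShape (Discrete σ) V) (α : U ⟶ V)
    (h : ∀ x, IsIso (α.app (freeFunctor x))) (P : J ⥤ AddCommGrpCat.{u}) [Projective P] :
    IsIso (α.app P) := by
  obtain ⟨σ, x, ⟨r⟩⟩ := exists_retract_sigma_freeFunctor P
  have : IsIso ((Discrete.functor fun s => freeFunctor (x s)).whiskerLeft α) := by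
    rw [NatTrans.isIso_iff_isIso_app]
    exact fun s => h (x s.as)
  have hs : IsIso (α.app (∐ fun s => freeFunctor (x s))) :=
    isIso_app_coconePt_of_preservesColimit (Discrete.functor fun s => freeFunctor (x s))
      α _ (coproductIsCoproduct _)
  -- Isomorphisms are stable under retracts in the arrow category.
  let ra : RetractArrow (α.app P) (α.app (∐ fun s => freeFunctor (x s))) :=
    { i := Arrow.homMk (U.map r.i) (V.map r.i) (by simp)
      r := Arrow.homMk (U.map r.r) (V.map r.r) (by simp)
      retract := by ext <;> simp [← Functor.map_comp] }
  exact (MorphismProperty.isomorphisms.iff _).1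
    (MorphismProperty.of_retract ra ((MorphismProperty.isomorphisms.iff _).2 hs))

end EnoughFree

end CategoryTheory

namespace FiniteSpace

noncomputable section

/-! ### Data supported on an open subset of a subspace. -/

section Support

variable {X : Type u} [TopologicalSpace X]

theorem mem_minOpen_iff {x p : X} :
    p ∈ minOpen x ↔ Specialization.toEquiv x ≤ Specialization.toEquiv p :=
  mem_nhdsKer_singleton

instance (S : Set X) : PreservesColimitsOfSize.{u, u} (restrict S) :=
  inferInstanceAs (PreservesColimitsOfSize.{u, u} ((Functor.whiskeringLeft _ _ _).obj (specMap _)))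

instance : PreservesColimitsOfSize.{u, u} (cosections X) :=
  inferInstanceAs (PreservesColimitsOfSize.{u, u} (colim (J := Specialization X)))

instance : PreservesFiniteColimits (cosections X) :=
  inferInstanceAs (PreservesFiniteColimits (colim (J := Specialization X)))

instance (S : Set X) : PreservesColimitsOfSize.{u, u} (cosectionsOn S) :=
  inferInstanceAs (PreservesColimitsOfSize.{u, u} (restrict S ⋙ cosections S))

theorem isZero_of_isEmpty [IsEmpty X] (F : AbData.{u, u} X) : IsZero F := by
  rw [Functor.isZero_iff]
  exact fun x => isEmptyElim (α := X) (Specialization.ofEquiv x)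

theorem isZero_cosectionsOn {S : Set X} {F : AbData.{u, u} X}
    (hF : ∀ s ∈ S, IsZero (F.obj (Specialization.toEquiv s))) :
    IsZero ((cosectionsOn S).obj F) := by
  rw [IsZero.iff_id_eq_zero]
  exact cosectionsOn_hom_ext fun s => (hF s.1 s.2).eq_of_src _ _

theorem map_toCosections (S : Set X) (F : AbData.{u, u} X) (s s' : S)
    (g : Specialization.toEquiv s.1 ⟶ Specialization.toEquiv s'.1) :
    F.map g ≫ toCosections S F s' = toCosections S F s := by
  have h : Specialization.ofEquiv (Specialization.toEquiv s') ⤳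
      Specialization.ofEquiv (Specialization.toEquiv s) :=
    Topology.IsInducing.subtypeVal.specializes_iff.1 g.le
  have g' : Specialization.toEquiv s ⟶ Specialization.toEquiv s' := homOfLE h
  exact colimit.w ((restrict S).obj F) g'

variable {S T : Set X} (h : T ⊆ S)

theorem specMap_nestedInc_le_iff (t t' : Specialization T) :
    (specMap (nestedInc h)).obj t ≤ (specMap (nestedInc h)).obj t' ↔ t ≤ t' :=
  ((Topology.IsEmbedding.inclusion h).isInducing).specializes_iff

instance : (specMap (nestedInc h)).Full where
  map_surjective {t t'} g :=
    ⟨homOfLE ((specMap_nestedInc_le_iff h t t').1 (leOfHom g)), Subsingleton.elim _ _⟩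

instance : (specMap (nestedInc h)).Faithful where
  map_injective _ := Subsingleton.elim _ _

variable (hup : ∀ t ∈ T, ∀ s ∈ S, Specialization.toEquiv t ≤ Specialization.toEquiv s → s ∈ T)
  (F : AbData.{u, u} X) (hF : ∀ s ∈ S, s ∉ T → IsZero (F.obj (Specialization.toEquiv s)))

include h hF hup

/-- The homology of abelian data on `S` supported on an open subset `T` of `S`. -/
theorem nonempty_homology_iso_of_support (n : ℕ) :
    Nonempty ((homology S n).obj ((restrict S).obj F) ≅
      (homology T n).obj ((restrict T).obj F)) := by
  refine nonempty_leftDerived_colim_iso (specMap (nestedInc h)) (fun s => ?_)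
    ((restrict S).obj F) (fun s hs => ?_) n
  · by_cases hs : (Specialization.ofEquiv s).1 ∈ T
    · exact Or.inl ⟨Specialization.toEquiv ⟨_, hs⟩, rfl⟩
    · refine Or.inr fun t => ⟨fun g => hs ?_⟩
      exact hup _ (Specialization.ofEquiv t).2 _ (Specialization.ofEquiv s).2
        ((specMap (subspaceInc S)).map g).le
  · refine hF _ (Specialization.ofEquiv s).2 fun hs' => hs ?_
    exact ⟨Specialization.toEquiv ⟨_, hs'⟩, rfl⟩

/-- Unlike the existence statement for homology, this concerns the canonical map, as the comparison
of L(f⁻¹(y), -) with f_! requires. -/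
theorem isIso_cosectionsMap_of_support : IsIso ((cosectionsMap h).app F) := by
  classical
  -- The inverse: canonical on T and zero outside. This is a cocone since arrows starting in T stay
  -- in T, and other arrows start at a zero object.
  obtain ⟨m, hm⟩ : ∃ m : ∀ s : S, F.obj (Specialization.toEquiv s.1) ⟶ (cosectionsOn T).obj F,
      ∀ (s : S) (hs : s.1 ∈ T), m s = toCosections T F ⟨s.1, hs⟩ :=
    ⟨fun s => if hs : s.1 ∈ T then toCosections T F ⟨s.1, hs⟩ else 0, fun _ hs => dif_pos hs⟩
  have hnat (s s' : S) (g : Specialization.toEquiv s.1 ⟶ Specialization.toEquiv s'.1) :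
      F.map g ≫ m s' = m s := by
    by_cases hs : s.1 ∈ T
    · rw [hm s hs, hm s' (hup _ hs _ s'.2 g.le)]
      exact map_toCosections T F ⟨_, hs⟩ ⟨_, hup _ hs _ s'.2 g.le⟩ g
    · exact (hF _ s.2 hs).eq_of_src _ _
  let c : Cocone ((restrict S).obj F) :=
    { pt := (cosectionsOn T).obj F
      ι :=
        { app := fun s => m (Specialization.ofEquiv s)
          naturality := fun s s' g =>
            (hnat (Specialization.ofEquiv s) (Specialization.ofEquiv s')
              ((specMap (subspaceInc S)).map g)).trans (Category.comp_id _).symm } }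
  let i : (cosectionsOn S).obj F ⟶ (cosectionsOn T).obj F := colimit.desc _ c
  have hi (s : S) (hs : s.1 ∈ T) : toCosections S F s ≫ i = toCosections T F ⟨s.1, hs⟩ := by
    exact (colimit.ι_desc c (Specialization.toEquiv s)).trans (hm s hs)
  refine ⟨i, cosectionsOn_hom_ext fun t => ?_, cosectionsOn_hom_ext fun s => ?_⟩
  · rw [← Category.assoc, toCosections_map, hi _ t.2]
    exact (Category.comp_id _).symm
  · by_cases hs : s.1 ∈ T
    · rw [← Category.assoc, hi _ hs, toCosections_map]
      exact (Category.comp_id _).symm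
    · exact (hF _ s.2 hs).eq_of_src _ _

end Support

/-! ### Cosections and homology of `freeData x`. -/

section Free

variable {X : Type u} [TopologicalSpace X] (x : X)

/-- Abelian data freely generated by a section at `x`, i.e. the extension by zero of the constant
data `ℤ` on `U_x`. -/
abbrev freeData : AbData.{u, u} X := freeFunctor (Specialization.toEquiv x)

theorem isZero_freeData_obj {p : X} (hp : p ∉ minOpen x) :
    IsZero ((freeData x).obj (Specialization.toEquiv p)) := by
  rw [IsZero.iff_id_eq_zero]
  refine Limits.Sigma.hom_ext _ _ fun g => ?_
  exact (hp (mem_minOpen_iff.2 g.le)).elim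

/-- The components of the augmentation of `freeData x`. -/
def augmentationApp (p : X) :
    (freeData x).obj (Specialization.toEquiv p) ⟶ AddCommGrpCat.of (ULift.{u} ℤ) :=
  Limits.Sigma.desc fun _ => 𝟙 _

theorem map_augmentationApp {p q : X} (g : Specialization.toEquiv p ⟶ Specialization.toEquiv q) :
    (freeData x).map g ≫ augmentationApp x q = augmentationApp x p := by
  refine Limits.Sigma.hom_ext _ _ fun g' => ?_
  have h1 : Sigma.ι (fun _ => AddCommGrpCat.of (ULift.{u} ℤ)) g' ≫ (freeData x).map g =
      Sigma.ι (fun _ => AddCommGrpCat.of (ULift.{u} ℤ)) (g' ≫ g) := Limits.Sigma.ι_desc _ _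
  refine (Category.assoc _ _ _).symm.trans ((congrArg (· ≫ augmentationApp x q) h1).trans ?_)
  have h2 : Sigma.ι (fun _ => AddCommGrpCat.of (ULift.{u} ℤ)) g' ≫ augmentationApp x p = 𝟙 _ :=
    Limits.Sigma.ι_desc _ _
  exact (Limits.Sigma.ι_desc _ _).trans h2.symm

theorem isIso_augmentationApp {p : X} (hp : p ∈ minOpen x) : IsIso (augmentationApp x p) := by
  let g : Specialization.toEquiv x ⟶ Specialization.toEquiv p := homOfLE (mem_minOpen_iff.1 hp)
  have h1 : Sigma.ι (fun _ => AddCommGrpCat.of (ULift.{u} ℤ)) g ≫ augmentationApp x p = 𝟙 _ :=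
    Limits.Sigma.ι_desc _ _
  refine ⟨Sigma.ι (fun _ => AddCommGrpCat.of (ULift.{u} ℤ)) g, ?_, h1⟩
  refine Limits.Sigma.hom_ext _ _ fun g' => ?_
  obtain rfl : g = g' := Subsingleton.elim _ _
  refine (Category.assoc _ _ _).symm.trans ((congrArg (· ≫ _) h1).trans ?_)
  exact (Category.id_comp _).trans (Category.comp_id _).symm

/-- The augmentation of `freeData x`. -/
def augmentation : freeData x ⟶ constData X (AddCommGrpCat.of (ULift.{u} ℤ)) where
  app p := augmentationApp x (Specialization.ofEquiv p)
  naturality _ _ g := (map_augmentationApp x g).trans (Category.comp_id _).symm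

/-- On a subspace of `U_x`, the abelian data `freeData x` is constant. -/
theorem nonempty_restrict_freeData_iso {T : Set X} (hT : T ⊆ minOpen x) :
    Nonempty ((restrict T).obj (freeData x) ≅ constData T (AddCommGrpCat.of (ULift.{u} ℤ))) := by
  have : IsIso ((restrict T).map (augmentation x)) := by
    rw [NatTrans.isIso_iff_isIso_app]
    exact fun t => isIso_augmentationApp x (hT (Specialization.ofEquiv t).2)
  let e := asIso ((restrict T).map (augmentation x))
  exact ⟨e⟩

/-- The morphism `L(T, freeData x) ⟶ ℤ` induced by the augmentation. -/
def cosectionsAugmentation (T : Set X) :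
    (cosectionsOn T).obj (freeData x) ⟶ AddCommGrpCat.of (ULift.{u} ℤ) :=
  (colimConstAdj.homEquiv _ _).symm ((restrict T).map (augmentation x))

theorem toCosections_augmentation (T : Set X) (t : T) :
    toCosections T (freeData x) t ≫ cosectionsAugmentation x T = augmentationApp x t.1 :=
  NatTrans.congr_app ((colimConstAdj.homEquiv _ _).apply_symm_apply
    ((restrict T).map (augmentation x))) (Specialization.toEquiv t)

theorem cosectionsMap_augmentation {T T' : Set X} (h : T ⊆ T') :
    (cosectionsMap h).app (freeData x) ≫ cosectionsAugmentation x T' =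
      cosectionsAugmentation x T := by
  refine cosectionsOn_hom_ext fun t => ?_
  rw [← Category.assoc, toCosections_map, toCosections_augmentation, toCosections_augmentation]

/-- On T the data is constant, and T is connected through its least element x. -/
theorem isIso_cosectionsAugmentation_of_mem {T : Set X} (hT : T ⊆ minOpen x) (hx : x ∈ T) :
    IsIso (cosectionsAugmentation x T) := by
  have := isIso_augmentationApp x (hT hx)
  refine ⟨inv (augmentationApp x x) ≫
    toCosections T (freeData x) ⟨x, hx⟩, cosectionsOn_hom_ext fun t => ?_, ?_⟩
  · have hi := isIso_augmentationApp x (hT t.2)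
    let g : Specialization.toEquiv x ⟶ Specialization.toEquiv t.1 :=
      homOfLE (mem_minOpen_iff.1 (hT t.2))
    have hg : (freeData x).map g ≫ augmentationApp x t.1 = augmentationApp x x :=
      map_augmentationApp x g
    have : IsIso ((freeData x).map g) := IsIso.of_isIso_fac_right hg
    have hw := map_toCosections T (freeData x) ⟨x, hx⟩ t g
    rw [← cancel_epi ((freeData x).map g), ← Category.assoc (toCosections T (freeData x) t),
      toCosections_augmentation, reassoc_of% hg, IsIso.hom_inv_id_assoc, ← hw]
    exact congrArg _ (Category.comp_id _).symm
  · rw [Category.assoc, toCosections_augmentation]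
    exact IsIso.inv_hom_id _

/-- A surjective endomorphism of ℤ is injective. This lets the abstract isomorphism H_0 ≅ ℤ of
`HomologicallyTrivial` control the augmentation. -/
theorem isIso_of_epi_of_iso {A : AddCommGrpCat.{u}} (e : A ≅ AddCommGrpCat.of (ULift.{u} ℤ))
    (g : A ⟶ AddCommGrpCat.of (ULift.{u} ℤ)) [Epi g] : IsIso g := by
  have : IsIso (e.inv ≫ g) := by
    have hs := (AddCommGrpCat.epi_iff_surjective (e.inv ≫ g)).1 inferInstance
    have hi : Function.Injective (e.inv ≫ g) :=
      OrzechProperty.injective_of_surjective_endomorphism (R := ℤ) (M := ULift.{u} ℤ)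
        (e.inv ≫ g).hom.toIntLinearMap hs
    rw [ConcreteCategory.isIso_iff_bijective]
    exact ⟨hi, hs⟩
  exact IsIso.of_isIso_comp_left e.inv g

/-- On the empty space H_0 is zero, hence not ℤ. -/
theorem HomologicallyTrivial.nonempty {T : Type u} [TopologicalSpace T]
    (h : HomologicallyTrivial T) : Nonempty T := by
  by_contra hT
  rw [not_nonempty_iff] at hT
  obtain ⟨e⟩ := h.2
  have h0 := ((cosections T).map_isZero (isZero_of_isEmpty
    (constData T (AddCommGrpCat.of (ULift.{u} ℤ))))).of_iso
      (e.symm ≪≫ (cosections T).leftDerivedZeroIsoSelf.app _)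
  have := AddCommGrpCat.subsingleton_of_isZero h0
  exact absurd (congrArg ULift.down (Subsingleton.elim (⟨0⟩ : ULift.{u} ℤ) ⟨1⟩)) (by simp)

theorem isIso_cosectionsAugmentation_of_homologicallyTrivial {T : Set X} (hT : T ⊆ minOpen x)
    (h : HomologicallyTrivial T) : IsIso (cosectionsAugmentation x T) := by
  obtain ⟨t⟩ := h.nonempty
  obtain ⟨e⟩ := nonempty_restrict_freeData_iso x hT
  obtain ⟨e'⟩ := h.2
  have := isIso_augmentationApp x (hT t.2)
  rw [← toCosections_augmentation x T t] at this
  have : Epi (cosectionsAugmentation x T) := epi_of_epi (toCosections T (freeData x) t) _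
  exact isIso_of_epi_of_iso (A := (cosectionsOn T).obj (freeData x)) ((cosections T).mapIso e ≪≫
    ((cosections T).leftDerivedZeroIsoSelf.app _).symm ≪≫ e') _

variable (S : Set X)

theorem nonempty_homology_restrict_freeData_iso (n : ℕ) :
    Nonempty ((homology S n).obj ((restrict S).obj (freeData x)) ≅
      (homology (minOpen x ∩ S : Set X) n).obj
        (constData _ (AddCommGrpCat.of (ULift.{u} ℤ)))) := by
  obtain ⟨e⟩ := nonempty_restrict_freeData_iso x (T := minOpen x ∩ S) Set.inter_subset_left
  obtain ⟨e'⟩ := nonempty_homology_iso_of_support (T := minOpen x ∩ S) Set.inter_subset_right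
    (fun _ ht _ hs hts => ⟨mem_minOpen_iff.2 ((mem_minOpen_iff.1 ht.1).trans hts), hs⟩)
    (freeData x) (fun _ hs hs' => isZero_freeData_obj x fun h => hs' ⟨h, hs⟩) n
  exact ⟨e' ≪≫ (homology _ n).mapIso e⟩

theorem isIso_cosectionsMap_freeData :
    IsIso ((cosectionsMap (Set.inter_subset_right : minOpen x ∩ S ⊆ S)).app (freeData x)) :=
  isIso_cosectionsMap_of_support Set.inter_subset_right
    (fun _ ht _ hs hts => ⟨mem_minOpen_iff.2 ((mem_minOpen_iff.1 ht.1).trans hts), hs⟩)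
    (freeData x) (fun _ hs hs' => isZero_freeData_obj x fun h => hs' ⟨h, hs⟩)

end Free

end

end FiniteSpace

/-! ### Homological openness and base change. -/

namespace FiniteSpace

noncomputable section

open Abelian

theorem hasExt_abData (X : Type u) [TopologicalSpace X] : HasExt.{u} (AbData.{u, u} X) :=
  hasExt_of_enoughProjectives _

variable {X : Type u} [TopologicalSpace X] {Y : Type v} [TopologicalSpace Y] (f : C(X, Y))

variable {f}

/-- Thus U_x meets f⁻¹(C_y) only when x itself lies there; this separates the trivial case in the
lemmas below. -/
theorem mem_preimage_closure {x p : X} {y : Y} (hp : p ∈ minOpen x)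
    (hy : p ∈ f ⁻¹' closure {y}) : x ∈ f ⁻¹' closure {y} := by
  rw [Set.mem_preimage, ← specializes_iff_mem_closure] at hy ⊢
  exact hy.trans ((mem_nhdsKer_singleton.1 hp).map f.continuous)

theorem mem_minOpen_of_mem_preimage_closure {x : X} {y : Y} (h : x ∈ f ⁻¹' closure {y}) :
    y ∈ minOpen (f x) :=
  mem_nhdsKer_singleton.2 (specializes_iff_mem_closure.2 h)

theorem isZero_restrict_freeData {x : X} {S : Set X} (h : ∀ p ∈ S, p ∉ minOpen x) :
    IsZero ((restrict S).obj (freeData x)) := by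
  rw [Functor.isZero_iff]
  exact fun p => isZero_freeData_obj x (h _ (Specialization.ofEquiv p).2)

theorem HomologicallyOpen.isZero_homology (hf : HomologicallyOpen f) (x : X) (y : Y) (n : ℕ) :
    IsZero ((homology (f ⁻¹' {y} : Set X) (n + 1)).obj
      ((restrict (f ⁻¹' {y})).obj (freeData x))) := by
  by_cases hx : x ∈ f ⁻¹' closure {y}
  · obtain ⟨e⟩ := nonempty_homology_restrict_freeData_iso x (f ⁻¹' {y}) (n + 1)
    exact ((hf.2 x y (mem_minOpen_of_mem_preimage_closure hx)).1 _ n.succ_pos).of_iso e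
  · have hz : IsZero ((restrict (f ⁻¹' {y})).obj (freeData x)) :=
      isZero_restrict_freeData fun p hp h => hx (mem_preimage_closure h (fiber_subset f y hp))
    have : Projective ((restrict (f ⁻¹' {y})).obj (freeData x)) := hz.projective
    exact Functor.isZero_leftDerived_obj_projective_succ _ _ _

/-- Restrictions to the fibers of a homologically open map send projective data to acyclic
data. -/
theorem HomologicallyOpen.subsingleton_ext [HasExt.{u} (AbData.{u, u} X)] (hf : HomologicallyOpen f)
    (y : Y) [HasExt.{u} (AbData.{u, u} (f ⁻¹' {y} : Set X))]
    (P : AbData.{u, u} X) [Projective P] (D : AddCommGrpCat.{u}) [Injective D] (n : ℕ) :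
    Subsingleton (Ext.{u} ((restrict (f ⁻¹' {y})).obj P)
      ((Functor.const (Specialization (f ⁻¹' {y} : Set X))).obj D) (n + 1)) := by
  obtain ⟨σ, x, ⟨r⟩⟩ := exists_retract_sigma_freeFunctor P
  have h (s : σ) : Subsingleton (Ext.{u}
      ((restrict (f ⁻¹' {y})).obj (freeFunctor (x s)))
      ((Functor.const (Specialization (f ⁻¹' {y} : Set X))).obj D) (n + 1)) :=
    subsingleton_ext_of_isZero_leftDerived colimConstAdj _ n
      (hf.isZero_homology (Specialization.ofEquiv (x s)) y n) D
  have e := PreservesCoproduct.iso (restrict (f ⁻¹' {y})) (fun s => freeFunctor (x s))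
  refine subsingleton_ext_of_retract ((r.map (restrict (f ⁻¹' {y}))).trans (.ofIso e)) _ _ ?_
  exact subsingleton_ext_sigma _ n _ h

/-- If f(x) ∈ C_y, both sides restrict to U_x without change, and there both augmentations to ℤ are
isomorphisms: one by triviality of the fiber, the other by the least element x. -/
theorem HomologicallyOpen.isIso_cosectionsMap_freeData (hf : HomologicallyOpen f) (x : X) (y : Y) :
    IsIso ((cosectionsMap (fiber_subset f y)).app (freeData x)) := by
  by_cases hx : x ∈ f ⁻¹' closure {y}
  · have hsub : minOpen x ∩ f ⁻¹' {y} ⊆ minOpen x ∩ f ⁻¹' closure {y} :=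
      Set.inter_subset_inter_right _ (fiber_subset f y)
    have := isIso_cosectionsAugmentation_of_homologicallyTrivial x Set.inter_subset_left
      (hf.2 x y (mem_minOpen_of_mem_preimage_closure hx))
    have := isIso_cosectionsAugmentation_of_mem x
      (T := minOpen x ∩ f ⁻¹' closure {y}) Set.inter_subset_left ⟨subset_nhdsKer rfl, hx⟩
    have := FiniteSpace.isIso_cosectionsMap_freeData x (f ⁻¹' {y})
    have := FiniteSpace.isIso_cosectionsMap_freeData x (f ⁻¹' closure {y})
    have h1 := cosectionsMap_augmentation x hsub
    have : IsIso ((cosectionsMap hsub).app (freeData x)) := IsIso.of_isIso_fac_right h1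
    have h2 : (cosectionsMap (Set.inter_subset_right : minOpen x ∩ f ⁻¹' {y} ⊆ _)).app
        (freeData x) ≫ (cosectionsMap (fiber_subset f y)).app (freeData x) =
      (cosectionsMap hsub).app (freeData x) ≫
        (cosectionsMap Set.inter_subset_right).app (freeData x) := by
      rw [← NatTrans.comp_app, ← NatTrans.comp_app, ← cosectionsMap_comp, ← cosectionsMap_comp]
    exact IsIso.of_isIso_fac_left h2
  · exact ⟨0, (isZero_cosectionsOn fun p hp => isZero_freeData_obj x fun h =>
        hx (mem_preimage_closure h (fiber_subset f y hp))).eq_of_src _ _,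
      (isZero_cosectionsOn fun p hp => isZero_freeData_obj x fun h =>
        hx (mem_preimage_closure h hp)).eq_of_src _ _⟩

theorem HomologicallyOpen.isIso_cosectionsMap (hf : HomologicallyOpen f) (y : Y)
    (P : AbData.{u, u} X) [Projective P] :
    IsIso ((cosectionsMap (fiber_subset f y)).app P) :=
  isIso_app_of_projective (fun _ => inferInstance) (fun _ => inferInstance) _
    (fun x => hf.isIso_cosectionsMap_freeData (Specialization.ofEquiv x) y) P

theorem isIso_comp_comp_comp {C : Type*} [Category* C] {U V W Z T : C} {a : U ⟶ V} {b : V ⟶ W}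
    {c : W ⟶ Z} {d : Z ⟶ T} (ha : IsIso a) (hb : IsIso b) (hc : IsIso c) (hd : IsIso d) :
    IsIso (a ≫ b ≫ c ≫ d) :=
  inferInstance

theorem isIso_homologyMap_comp {C ι : Type*} [Category* C] [Abelian C] {c : ComplexShape ι}
    {K L M : HomologicalComplex C c} {φ : K ⟶ L} {ψ : L ⟶ M} {i : ι}
    (hφ : IsIso (HomologicalComplex.homologyMap φ i))
    (hψ : IsIso (HomologicalComplex.homologyMap ψ i)) :
    IsIso (HomologicalComplex.homologyMap (φ ≫ ψ) i) := by
  rw [HomologicalComplex.homologyMap_comp]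
  infer_instance

theorem isIso_baseChange (i : ℕ) (F : AbData.{u, u} X) (y : Y)
    (h : IsIso (HomologicalComplex.homologyMap
      (((cosections _).mapHomologicalComplex _).map
        (liftToResolution (projectiveResolution ((restrict (f ⁻¹' {y})).obj F)) _
          (restrictAugmentation (f ⁻¹' {y}) (projectiveResolution F))) ≫
      (NatTrans.mapHomologicalComplex (baseChange₀ f y) _).app
        (projectiveResolution F).complex) i)) :
    IsIso (baseChange f i F y) := by
  exact isIso_comp_comp_comp (Iso.isIso_hom _) h (Iso.isIso_hom _)
    (Functor.map_isIso _ ((projectiveResolution F).isoLeftDerivedObj (lowerShriek f) i).inv)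

theorem HomologicallyOpen.satisfiesHomologicalBaseChange (hf : HomologicallyOpen f) :
    SatisfiesHomologicalBaseChange f := by
  intro F y i
  have := hasExt_abData X
  have := hasExt_abData (f ⁻¹' {y} : Set X)
  let P := projectiveResolution F
  let Q := projectiveResolution ((restrict (f ⁻¹' {y})).obj F)
  let K : ChainComplex (AbData.{u, u} (f ⁻¹' {y} : Set X)) ℕ :=
    ((restrict (f ⁻¹' {y})).mapHomologicalComplex (ComplexShape.down ℕ)).obj P.complex
  let ε := restrictAugmentation (f ⁻¹' {y}) P
  let φ : Q.complex ⟶ K := liftToResolution Q _ ε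
  have hφ : φ ≫ ε = Q.π := liftToResolution_comp Q _ ε
  have hφq : QuasiIso φ := by
    have : QuasiIso (φ ≫ ε) := by rw [hφ]; infer_instance
    exact quasiIso_of_comp_right φ ε
  have hK (n : ℕ) : K.ExactAt (n + 1) :=
    (quasiIsoAt_iff_exactAt' ε (n + 1) (ChainComplex.exactAt_succ_single_obj _ _)).1 inferInstance
  have hQ (n : ℕ) : Q.complex.ExactAt (n + 1) :=
    (quasiIsoAt_iff_exactAt' Q.π (n + 1)
      (ChainComplex.exactAt_succ_single_obj _ _)).1 inferInstance
  have hφ0 : IsIso (HomologicalComplex.opcyclesMap φ 0) := by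
    have h := ChainComplex.isoHomologyι₀_inv_naturality φ
    have : IsIso (HomologicalComplex.opcyclesMap φ 0 ≫ K.isoHomologyι₀.inv) := by
      rw [← h]; infer_instance
    exact IsIso.of_isIso_comp_right _ K.isoHomologyι₀.inv
  -- Q has projective terms and K has terms acyclic by homological openness, so cosections preserve
  -- the quasi-isomorphism φ.
  have h1 : IsIso (HomologicalComplex.homologyMap
      (((cosections _).mapHomologicalComplex _).map φ) i) :=
    isIso_homologyMap_of_acyclic colimConstAdj φ hQ hK
      (fun D _ n j => Ext.subsingleton_of_projective _ _ _)
      (fun D _ n j => hf.subsingleton_ext y (P.complex.X n) D j) i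
  have h2 : IsIso ((NatTrans.mapHomologicalComplex (baseChange₀ f y) _).app P.complex) := by
    have (n : ℕ) : IsIso (((NatTrans.mapHomologicalComplex (baseChange₀ f y) _).app
        P.complex).f n) := hf.isIso_cosectionsMap y (P.complex.X n)
    exact HomologicalComplex.Hom.isIso_of_components _
  have h3 : IsIso (HomologicalComplex.homologyMap
    ((NatTrans.mapHomologicalComplex (baseChange₀ f y) _).app P.complex) i) := inferInstance
  exact isIso_baseChange i F y (isIso_homologyMap_comp h1 h3)

/-- In a finite space the open sets are those stable under generalization, and a generalization of
f(x) lifts to U_x. -/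
theorem isOpenMap_of_nonempty [Finite Y]
    (h : ∀ x : X, ∀ y ∈ minOpen (f x), (minOpen x ∩ f ⁻¹' {y}).Nonempty) : IsOpenMap f := by
  intro U hU
  rw [isOpen_iff_forall_specializes]
  rintro y _ hy ⟨x, hx, rfl⟩
  obtain ⟨p, hp, rfl⟩ := h x y (mem_nhdsKer_singleton.2 hy)
  exact ⟨p, (mem_nhdsKer_singleton.1 hp).mem_open hU hx, rfl⟩

theorem SatisfiesHomologicalBaseChange.homologicallyTrivial
    (hf : SatisfiesHomologicalBaseChange f) (x : X) (y : Y) (hy : y ∈ minOpen (f x)) :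
    HomologicallyTrivial (minOpen x ∩ f ⁻¹' {y} : Set X) := by
  have hx : x ∈ f ⁻¹' closure {y} :=
    specializes_iff_mem_closure.1 (mem_nhdsKer_singleton.1 hy)
  have key (n : ℕ) : Nonempty ((homology (minOpen x ∩ f ⁻¹' {y} : Set X) n).obj
        (constData _ (AddCommGrpCat.of (ULift.{u} ℤ))) ≅
      ((derivedLowerShriek f n).obj (freeData x)).obj (Specialization.toEquiv y)) := by
    obtain ⟨e⟩ := nonempty_homology_restrict_freeData_iso x (f ⁻¹' {y}) n
    have := hf (freeData x) y n
    exact ⟨e.symm ≪≫ asIso (baseChange f n (freeData x) y)⟩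
  refine ⟨fun i hi => ?_, ?_⟩
  · obtain ⟨n, rfl⟩ := Nat.exists_eq_succ_of_ne_zero hi.ne'
    obtain ⟨e⟩ := key (n + 1)
    refine IsZero.of_iso ?_ e
    exact (Functor.isZero_iff _).1
      (Functor.isZero_leftDerived_obj_projective_succ (lowerShriek f) n (freeData x)) _
  · obtain ⟨e⟩ := key 0
    have := isIso_cosectionsAugmentation_of_mem x
      (T := minOpen x ∩ f ⁻¹' closure {y}) Set.inter_subset_left ⟨subset_nhdsKer rfl, hx⟩
    have := isIso_cosectionsMap_freeData x (f ⁻¹' closure {y})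
    let e' : (cosectionsOn (f ⁻¹' closure {y})).obj (freeData x) ≅
        AddCommGrpCat.of (ULift.{u} ℤ) :=
      (asIso ((cosectionsMap (Set.inter_subset_right :
        minOpen x ∩ f ⁻¹' closure {y} ⊆ _)).app (freeData x))).symm ≪≫
          asIso (cosectionsAugmentation x _)
    exact ⟨e ≪≫ (asIso ((lowerShriek f).fromLeftDerivedZero.app (freeData x))).app _ ≪≫ e'⟩

end

end FiniteSpace

theorem mainTheorem2 {X : Type u} {Y : Type v} [TopologicalSpace X] [TopologicalSpace Y]
    [Finite X] [Finite Y] (f : C(X, Y)) :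
    FiniteSpace.HomologicallyOpen f ↔ FiniteSpace.SatisfiesHomologicalBaseChange f := by
  refine ⟨fun h => h.satisfiesHomologicalBaseChange, fun h => ?_⟩
  have ht := h.homologicallyTrivial
  exact ⟨FiniteSpace.isOpenMap_of_nonempty fun x y hy =>
    Set.nonempty_coe_sort.1 (ht x y hy).nonempty, ht⟩
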